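/- Let $M$ be a finite matroid with ground set $E$ and rank function $r$. For a finite tree $T$ let $\|T\|$ be its number of edges. A depth-decomposition of $M$ is a pair $(T,f)$, where $T$ is a finite rooted tree and $f:E\to V(T)$ is a map such that $r(E)=\|T\|$ and $r(X)\le\|T^*(X)\|$ for every $X\subseteq E$; here $T^*(X)$ is the union of the paths in $T$ from the root to the vertices of $f(X)$ (with no edges if $X=\emptyset$). The depth of a rooted tree is the length (number of edges) of a longest path from the root to a leaf, a one-vertex tree having depth $0$. The branch-depth $\mathrm{bd}(M)$ is the smallest depth of a rooted tree $T$ such that some $(T,f)$ is a depth-decomposition of $M$. If $M$ has at least one circuit and $\ell$ is the size of the largest circuit of $M$, then $$\mathrm{bd}(M)\le \ell^2 .$$ -/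

import Mathlib

namespace SimpleGraph

/-- The depth of the tree `T` rooted at `root`: the length of a longest path starting at the root.
(In a finite tree such a path ends in a leaf.) -/
noncomputable def rootedDepth {V : Type*} (T : SimpleGraph V) (root : V) : ℕ∞ :=
  ⨆ (v : V) (p : T.Path root v), (p.1.length : ℕ∞)

/-- The edges of the union of the paths of `T` from the root to the vertices in `S`. -/
def rootPathEdges {V : Type*} (T : SimpleGraph V) (root : V) (S : Set V) : Set (Sym2 V) :=
  {e | ∃ v ∈ S, ∃ p : T.Path root v, e ∈ p.1.edges}

end SimpleGraph

namespace Matroid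

/-- `(T, f)`, with `T` rooted at `root`, is a depth-decomposition of `M`: the tree `T` has exactly
`r(M)` edges, and every set `X` of elements of `M` has rank at most the number of edges of
the union of the paths from the root to the vertices in `f(X)`.
Only the values of `f` on the ground set of `M` matter. -/
structure IsDepthDecomposition {α V : Type*} (M : Matroid α)
    (T : SimpleGraph V) (root : V) (f : α → V) : Prop where
  isTree : T.IsTree
  eRank_eq : M.eRank = T.edgeSet.encard
  eRk_le : ∀ X ⊆ M.E, M.eRk X ≤ (T.rootPathEdges root (f '' X)).encard

/-- The branch-depth of `M`: the smallest depth of a (finite) rooted tree `T` for which some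
`(T, f)` is a depth-decomposition of `M`. The value would be `⊤` if there were none. -/
noncomputable def branchDepth {α : Type*} (M : Matroid α) : ℕ∞ :=
  sInf {d | ∃ (V : Type) (_ : Finite V) (T : SimpleGraph V) (root : V) (f : α → V),
    M.IsDepthDecomposition T root f ∧ T.rootedDepth root = d}

end Matroid

/-!
If `M` is a direct sum of two matroids of positive rank, glue their decompositions at the roots.
Otherwise any two nonloops lie in a common circuit. Take a largest circuit `C`. Every circuit of
`M ／ C` is smaller than `C`, so `M ／ C` has a decomposition by induction, and hanging it below a
path with `r(C) = |C| - 1` edges decomposes `M`. The lengths of these paths add up to at most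
`(ℓ - 1) + (ℓ - 2) + ⋯ + 1 = ℓ.choose 2`, and what remains has rank at most `1`.

To see that a circuit `D` of `M ／ C` is smaller than `C`, suppose that it is not. Then `D` is a
circuit of `M`. Among the circuits meeting both `C` and `D` choose `Z` with `Z \ (C ∪ D)` minimal,
and let `w ∈ Z \ (C ∪ D)`. By minimality, `C` and `D` are the only circuits in `Z ∪ C ∪ D` that
avoid `w`, so eliminating an element of `Z ∩ C` from `Z` and `C` yields a circuit `Z'` with
`Z' \ C = Z \ C` and `C ⊆ Z ∪ Z'`: one of `Z`, `Z'` contains at least half of `C`. Doing the same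
for `D` gives a circuit that contains `w`, at least half of `C` and at least half of `D`. It has
more than `(|C| + |D|) / 2 ≥ |C|` elements, a contradiction.
-/

namespace BranchDepth

open Set Matroid

section Rank

variable {α : Type*} {M : Matroid α} {S : Set α}

theorem eRk_union_eq_contract_eRk_add_eRk (M : Matroid α) (X C : Set α) :
    M.eRk (X ∪ C) = (M ／ C).eRk X + M.eRk C := by
  obtain ⟨I, hI⟩ := M.exists_isBasis' C
  obtain ⟨J, hJ, hIJ⟩ := hI.indep.subset_isBasis'_of_subset (hI.subset.trans subset_union_right)
  have hJC : J ∩ C = I := (hI.eq_of_subset_indep (hJ.indep.inter_right C)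
    (subset_inter hIJ hI.subset) inter_subset_right).symm
  have hJ_contract : (M ／ C).IsBasis' (J \ C) ((X ∪ C) \ C) :=
    hJ.contract_isBasis' hI (hJ.indep.subset (union_subset sdiff_subset hIJ))
  have h_ground : (M ／ C).eRk ((X ∪ C) \ C) = (M ／ C).eRk X := by
    rw [← eRk_inter_ground, ← eRk_inter_ground _ X, contract_ground]
    congr 1
    tauto_set
  rw [← h_ground, ← hJ_contract.encard_eq_eRk, ← hI.encard_eq_eRk, ← hJ.encard_eq_eRk, ← hJC,
    encard_sdiff_add_encard_inter]

theorem eRank_eq_contract_eRank_add_eRk (M : Matroid α) (C : Set α) :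
    M.eRank = (M ／ C).eRank + M.eRk C := by
  simpa only [univ_union, eRk_univ_eq] using eRk_union_eq_contract_eRk_add_eRk M univ C

theorem delete_eRk (M : Matroid α) (D X : Set α) : (M ＼ D).eRk X = M.eRk (X \ D) := by
  rw [delete_eq_restrict, restrict_eRk_eq', ← M.eRk_inter_ground (X \ D)]
  congr 1
  tauto_set

theorem delete_eRank (M : Matroid α) (D : Set α) : (M ＼ D).eRank = M.eRk Dᶜ := by
  rw [← eRk_univ_eq, delete_eRk, compl_eq_univ_sdiff]

theorem eRk_add_eRk_compl_eq_eRank (hS : ∀ Z, M.IsCircuit Z → (Z ∩ S).Nonempty → Z ⊆ S) :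
    M.eRk S + M.eRk Sᶜ = M.eRank := by
  refine le_antisymm ?_ ?_
  · obtain ⟨I, hI⟩ := M.exists_isBasis' S
    obtain ⟨J, hJ⟩ := M.exists_isBasis' Sᶜ
    have hIJ : M.Indep (I ∪ J) := by
      rw [indep_iff_forall_subset_not_isCircuit
        (union_subset hI.indep.subset_ground hJ.indep.subset_ground)]
      intro Z hZIJ hZ
      by_cases hZS : (Z ∩ S).Nonempty
      · exact hZ.not_indep <| hI.indep.subset fun z hz ↦
          (hZIJ hz).resolve_right fun hzJ ↦ hJ.subset hzJ (hS Z hZ hZS hz)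
      · exact hZ.not_indep <| hJ.indep.subset fun z hz ↦
          (hZIJ hz).resolve_left fun hzI ↦ hZS ⟨z, hz, hI.subset hzI⟩
    rw [← hI.encard_eq_eRk, ← hJ.encard_eq_eRk,
      ← encard_union_eq (disjoint_compl_right.mono hI.subset hJ.subset)]
    exact hIJ.encard_le_eRank
  · simpa only [union_compl_self, eRk_univ_eq] using M.eRk_union_le_eRk_add_eRk S Sᶜ

end Rank

section Circuits

variable {α : Type*} {M : Matroid α} {A B C D Y Z : Set α} {w x y z : α}

theorem exists_isCircuit_elim_inter_sdiff_nonempty (hA : M.IsCircuit A) (hB : M.IsCircuit B)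
    (hyA : y ∈ A) (hyB : y ∈ B) (hxA : x ∈ A) (hxB : x ∉ B) :
    ∃ A' ⊆ (A ∪ B) \ {y}, M.IsCircuit A' ∧ x ∈ A' ∧ (A' ∩ (B \ A)).Nonempty := by
  obtain ⟨A', hA'_sub, hA', hxA'⟩ := hA.strong_elimination hB hyA hyB hxA hxB
  refine ⟨A', hA'_sub, hA', hxA', ?_⟩
  by_contra! h_empty
  have hA'A : A' ⊆ A := fun u hu ↦ by
    by_contra huA
    exact h_empty.subset ⟨hu, (hA'_sub hu).1.resolve_left huA, huA⟩
  obtain rfl : A' = A := hA'.eq_of_subset_isCircuit hA hA'A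
  exact (hA'_sub hyA).2 rfl

theorem exists_isCircuit_mem_mem_of_inter_nonempty [M.Finitary] (hA : M.IsCircuit A)
    (hB : M.IsCircuit B) (hAB : (A ∩ B).Nonempty) (hx : x ∈ A) (hz : z ∈ B) :
    ∃ Z, M.IsCircuit Z ∧ x ∈ Z ∧ z ∈ Z := by
  obtain ⟨⟨A, B⟩, ⟨hA, hB, ⟨y, hyA, hyB⟩, hx, hz⟩, hmin⟩ := exists_minimalFor_of_wellFoundedLT
    (fun P : Set α × Set α ↦ M.IsCircuit P.1 ∧ M.IsCircuit P.2 ∧ (P.1 ∩ P.2).Nonempty ∧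
      x ∈ P.1 ∧ z ∈ P.2) (fun P ↦ (P.1 ∪ P.2).ncard) ⟨(A, B), hA, hB, hAB, hx, hz⟩
  dsimp only at hA hB hyA hyB hx hz
  by_cases hxB : x ∈ B
  · exact ⟨B, hB, hxB, hz⟩
  by_cases hzA : z ∈ A
  · exact ⟨A, hA, hx, hzA⟩
  have union_eq_of_subset : ∀ {A' B'}, M.IsCircuit A' → M.IsCircuit B' → (A' ∩ B').Nonempty →
      x ∈ A' → z ∈ B' → A' ∪ B' ⊆ A ∪ B → A' ∪ B' = A ∪ B := by
    intro A' B' hA' hB' hne hxA' hzB' hsub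
    have hfin : (A ∪ B).Finite := hA.finite.union hB.finite
    exact eq_of_subset_of_ncard_le hsub
      (hmin (j := (A', B')) ⟨hA', hB', hne, hxA', hzB'⟩ (ncard_le_ncard hsub hfin)) hfin
  obtain ⟨A', hA'_sub, hA', hxA', a, haA', haB, -⟩ :=
    exists_isCircuit_elim_inter_sdiff_nonempty hA hB hyA hyB hx hxB
  obtain ⟨B', hB'_sub, hB', hzB', b, hbB', hbA, hbB⟩ :=
    exists_isCircuit_elim_inter_sdiff_nonempty hB hA hyB hyA hz hzA
  have hA'B : A' ∪ B = A ∪ B := union_eq_of_subset hA' hB ⟨a, haA', haB⟩ hxA' hz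
    (union_subset (hA'_sub.trans sdiff_subset) subset_union_right)
  have hbA' : b ∈ A' := (hA'B.superset (Or.inl hbA)).resolve_right hbB
  have hsub : A' ∪ B' ⊆ (A ∪ B) \ {y} := union_subset hA'_sub (union_comm A B ▸ hB'_sub)
  have hA'B' : A' ∪ B' = A ∪ B :=
    union_eq_of_subset hA' hB' ⟨b, hbA', hbB'⟩ hxA' hzB' (hsub.trans sdiff_subset)
  exact ((hsub (hA'B'.superset (Or.inl hyA))).2 rfl).elim

/-- Connectedness up to loops: any two distinct nonloops lie in a common circuit. Unlike
connectedness itself, this condition does not exclude loops, so they need not be deleted. -/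
def NonloopsConnected (M : Matroid α) : Prop :=
  ∀ ⦃x y⦄, M.IsNonloop x → M.IsNonloop y → x ≠ y → ∃ Z, M.IsCircuit Z ∧ x ∈ Z ∧ y ∈ Z

theorem exists_eRk_add_eRk_compl_eq_eRank_of_not_nonloopsConnected [M.Finitary]
    (hM : ¬ NonloopsConnected M) :
    ∃ S, M.eRk S + M.eRk Sᶜ = M.eRank ∧ M.eRk S ≠ 0 ∧ M.eRk Sᶜ ≠ 0 := by
  simp only [NonloopsConnected, not_forall] at hM
  obtain ⟨x, y, hx, hy, hxy, hxyZ⟩ := hM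
  have eRk_ne_zero : ∀ {e A}, M.IsNonloop e → e ∈ A → M.eRk A ≠ 0 := fun he heA h ↦
    zero_lt_one.not_ge (he.eRk_eq.symm.trans_le (h ▸ M.eRk_mono (singleton_subset_iff.2 heA)))
  refine ⟨insert x {z | ∃ Z, M.IsCircuit Z ∧ x ∈ Z ∧ z ∈ Z}, eRk_add_eRk_compl_eq_eRank ?_,
    eRk_ne_zero hx (mem_insert ..), eRk_ne_zero hy fun h ↦ h.elim (hxy ·.symm) hxyZ⟩
  rintro Z hZ ⟨u, huZ, rfl | ⟨Y, hY, hxY, huY⟩⟩ z hz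
  · exact Or.inr ⟨Z, hZ, huZ, hz⟩
  · exact Or.inr (exists_isCircuit_mem_mem_of_inter_nonempty hY hZ ⟨u, huY, huZ⟩ hxY hz)

/-- `Z` is a circuit that meets both `C` and `D`. -/
structure IsLink (M : Matroid α) (C D Z : Set α) : Prop where
  isCircuit : M.IsCircuit Z
  inter_left_nonempty : (Z ∩ C).Nonempty
  inter_right_nonempty : (Z ∩ D).Nonempty

/-- Among all circuits meeting both `C` and `D`, the circuit `Z` has the fewest elements outside
`C ∪ D`. This is what rules out further circuits in `Z ∪ C ∪ D`. -/
def IsMinimalLink (M : Matroid α) (C D Z : Set α) : Prop :=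
  MinimalFor (IsLink M C D) (fun Z ↦ (Z \ (C ∪ D)).ncard) Z

theorem IsLink.symm (hZ : IsLink M C D Z) : IsLink M D C Z :=
  ⟨hZ.isCircuit, hZ.inter_right_nonempty, hZ.inter_left_nonempty⟩

theorem IsLink.exists_isMinimalLink (hZ : IsLink M C D Z) : ∃ Z, IsMinimalLink M C D Z :=
  exists_minimalFor_of_wellFoundedLT _ _ ⟨Z, hZ⟩

theorem IsMinimalLink.symm (hZ : IsMinimalLink M C D Z) : IsMinimalLink M D C Z :=
  ⟨hZ.1.symm, fun Y hY ↦ by simpa only [union_comm D C] using @hZ.2 Y hY.symm⟩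

theorem IsMinimalLink.mem_of_isLink [M.Finitary] (hZ : IsMinimalLink M C D Z)
    (hY : IsLink M C D Y) (hYZ : Y ⊆ Z ∪ C ∪ D) (hw : w ∈ Z \ (C ∪ D)) : w ∈ Y := by
  have hfin : (Z \ (C ∪ D)).Finite := hZ.1.isCircuit.finite.sdiff
  have hsub : Y \ (C ∪ D) ⊆ Z \ (C ∪ D) := fun u ⟨huY, hu⟩ ↦
    ⟨(union_assoc Z C D ▸ hYZ huY).resolve_right hu, hu⟩
  have heq : Y \ (C ∪ D) = Z \ (C ∪ D) :=
    eq_of_subset_of_ncard_le hsub (hZ.2 hY (ncard_le_ncard hsub hfin)) hfin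
  exact (heq.superset hw).1

theorem IsMinimalLink.eq_right_of_disjoint_left [M.Finitary] (hZ : IsMinimalLink M C D Z)
    (hD : M.IsCircuit D) (hY : M.IsCircuit Y) (hYZ : Y ⊆ Z ∪ D)
    (hYC : Disjoint Y C) : Y = D := by
  refine hY.eq_of_subset_isCircuit hD fun v hvY ↦ ?_
  by_contra hvD
  have hvZ : v ∈ Z := (hYZ hvY).resolve_right hvD
  obtain ⟨a, haZ, haC⟩ := hZ.1.inter_left_nonempty
  obtain ⟨Y', hY'_sub, hY', haY', u, huY', huY, huZ⟩ := exists_isCircuit_elim_inter_sdiff_nonempty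
    hZ.1.isCircuit hY hvZ hvY haZ (hYC.notMem_of_mem_right haC)
  have hY'_link : IsLink M C D Y' :=
    ⟨hY', ⟨a, haY', haC⟩, u, huY', (hYZ huY).resolve_left huZ⟩
  have hY'_sub' : Y' ⊆ Z ∪ C ∪ D := hY'_sub.trans <| sdiff_subset.trans <|
    union_subset (subset_union_left.trans subset_union_left)
      (hYZ.trans (union_subset_union_left D subset_union_left))
  have hvY' : v ∈ Y' := hZ.mem_of_isLink hY'_link hY'_sub'
    ⟨hvZ, fun h ↦ h.elim (hYC.notMem_of_mem_left hvY) hvD⟩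
  exact (hY'_sub hvY').2 rfl

theorem IsMinimalLink.eq_or_eq_of_notMem [M.Finitary] (hZ : IsMinimalLink M C D Z)
    (hC : M.IsCircuit C) (hD : M.IsCircuit D) (hw : w ∈ Z \ (C ∪ D)) (hY : M.IsCircuit Y)
    (hYZ : Y ⊆ Z ∪ C ∪ D) (hwY : w ∉ Y) : Y = C ∨ Y = D := by
  by_cases hYC : Disjoint Y C
  · rw [union_right_comm] at hYZ
    exact .inr (hZ.eq_right_of_disjoint_left hD hY (hYC.subset_left_of_subset_union hYZ) hYC)
  by_cases hYD : Disjoint Y D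
  · exact .inl (hZ.symm.eq_right_of_disjoint_left hC hY (hYD.subset_left_of_subset_union hYZ) hYD)
  rw [not_disjoint_iff_nonempty_inter] at hYC hYD
  exact absurd (hZ.mem_of_isLink ⟨hY, hYC, hYD⟩ hYZ hw) hwY

theorem exists_isCircuit_sdiff_eq_subset_union (hC : M.IsCircuit C) (hZ : M.IsCircuit Z)
    (hZC : (Z ∩ C).Nonempty) (hw : w ∈ Z \ C)
    (hunique : ∀ Y, M.IsCircuit Y → Y ⊆ Z ∪ C → w ∉ Y → Y = C) :
    ∃ Z', M.IsCircuit Z' ∧ w ∈ Z' ∧ Z' \ C = Z \ C ∧ C ⊆ Z ∪ Z' := by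
  obtain ⟨a, haZ, haC⟩ := hZC
  obtain ⟨Z', hZ'_sub, hZ', hwZ'⟩ := hZ.strong_elimination hC haZ haC hw.1 hw.2
  have haZ' : a ∉ Z' := fun h ↦ (hZ'_sub h).2 rfl
  have eq_of_elim : ∀ Y ⊆ (Z ∪ Z') \ {w}, M.IsCircuit Y → Y = C := fun Y hY_sub hY ↦
    hunique Y hY (fun u hu ↦ (hY_sub hu).1.elim .inl fun h ↦ (hZ'_sub h).1) fun h ↦ (hY_sub h).2 rfl
  obtain ⟨Y, hY_sub, hY⟩ := hZ.elimination hZ' (fun h ↦ haZ' (h ▸ haZ)) w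
  have hZZ'C : Z \ C ⊆ Z' := by
    rintro u ⟨huZ, huC⟩
    by_contra huZ'
    obtain ⟨Y, hY_sub, hY, huY⟩ := hZ.strong_elimination hZ' hw.1 hwZ' huZ huZ'
    exact huC (eq_of_elim Y hY_sub hY ▸ huY)
  refine ⟨Z', hZ', hwZ', ?_, eq_of_elim Y hY_sub hY ▸ hY_sub.trans sdiff_subset⟩
  exact Subset.antisymm (fun u ⟨hu, huC⟩ ↦ ⟨(hZ'_sub hu).1.resolve_right huC, huC⟩)
    fun u hu ↦ ⟨hZZ'C hu, hu.2⟩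

theorem exists_isCircuit_sdiff_eq_ncard_le [M.Finitary] (hC : M.IsCircuit C) (hZ : M.IsCircuit Z)
    (hZC : (Z ∩ C).Nonempty) (hw : w ∈ Z \ C)
    (hunique : ∀ Y, M.IsCircuit Y → Y ⊆ Z ∪ C → w ∉ Y → Y = C) :
    ∃ Z', M.IsCircuit Z' ∧ Z' \ C = Z \ C ∧ C.ncard ≤ 2 * (Z' ∩ C).ncard := by
  obtain ⟨Z', hZ', -, hdiff, hcover⟩ :=
    exists_isCircuit_sdiff_eq_subset_union hC hZ hZC hw hunique
  have hle : C.ncard ≤ (Z ∩ C).ncard + (Z' ∩ C).ncard := calc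
    C.ncard = ((Z ∩ C) ∪ (Z' ∩ C)).ncard := by
      rw [← union_inter_distrib_right, inter_eq_self_of_subset_right hcover]
    _ ≤ _ := ncard_union_le _ _
  rcases le_total (Z ∩ C).ncard (Z' ∩ C).ncard with h | h
  · exact ⟨Z', hZ', hdiff, by lia⟩
  · exact ⟨Z, hZ, rfl, by lia⟩

theorem exists_isCircuit_ncard_add_ncard_lt [M.Finitary] (hC : M.IsCircuit C) (hD : M.IsCircuit D)
    (hCD : Disjoint C D) (hZ : IsLink M C D Z) (hw : w ∈ Z \ (C ∪ D))
    (hunique : ∀ Y, M.IsCircuit Y → Y ⊆ Z ∪ C ∪ D → w ∉ Y → Y = C ∨ Y = D) :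
    ∃ Z', M.IsCircuit Z' ∧ C.ncard + D.ncard < 2 * Z'.ncard := by
  rw [mem_sdiff, mem_union, not_or] at hw
  obtain ⟨hwZ, hwC, hwD⟩ := hw
  have hD_not_subset : ¬ D ⊆ Z ∪ C := fun h ↦
    hwD (hD.eq_of_subset_isCircuit hZ.isCircuit (hCD.symm.subset_left_of_subset_union h) ▸ hwZ)
  obtain ⟨Z₁, hZ₁, hZ₁C, hcard₁⟩ := exists_isCircuit_sdiff_eq_ncard_le hC hZ.isCircuit
    hZ.inter_left_nonempty ⟨hwZ, hwC⟩ fun Y hY hYZ hwY ↦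
      (hunique Y hY (hYZ.trans subset_union_left) hwY).resolve_right
        fun h ↦ hD_not_subset (h ▸ hYZ)
  have hZ₁_union : Z₁ ∪ C = Z ∪ C := by rw [← sdiff_union_self, hZ₁C, sdiff_union_self]
  have hZ₁_sdiff : Z \ C ⊆ Z₁ := hZ₁C ▸ sdiff_subset
  have hwZ₁ : w ∈ Z₁ := hZ₁_sdiff ⟨hwZ, hwC⟩
  have hC_not_subset : ¬ C ⊆ Z₁ ∪ D := fun h ↦
    hwC (hC.eq_of_subset_isCircuit hZ₁ (hCD.subset_left_of_subset_union h) ▸ hwZ₁)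
  have hZ₁D : (Z₁ ∩ D).Nonempty := by
    obtain ⟨u, huZ, huD⟩ := hZ.inter_right_nonempty
    exact ⟨u, hZ₁_sdiff ⟨huZ, hCD.notMem_of_mem_right huD⟩, huD⟩
  obtain ⟨Z₂, hZ₂, hZ₂D, hcard₂⟩ := exists_isCircuit_sdiff_eq_ncard_le hD hZ₁ hZ₁D ⟨hwZ₁, hwD⟩
    fun Y hY hYZ hwY ↦ (hunique Y hY (hYZ.trans (union_subset_union_left D
      (hZ₁_union ▸ subset_union_left))) hwY).resolve_left fun h ↦ hC_not_subset (h ▸ hYZ)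
  have hcard_lt : (Z₁ ∩ C).ncard < (Z₂ \ D).ncard := by
    rw [hZ₂D]
    refine ncard_lt_ncard ⟨fun u ⟨huZ, huC⟩ ↦ ⟨huZ, hCD.notMem_of_mem_left huC⟩, fun h ↦ ?_⟩
      hZ₁.finite.sdiff
    exact hwC (h ⟨hwZ₁, hwD⟩).2
  have hcard_Z₂ := ncard_inter_add_ncard_sdiff_eq_ncard Z₂ D hZ₂.finite
  exact ⟨Z₂, hZ₂, by lia⟩

theorem isCircuit_of_contract_isCircuit_of_forall_ncard_le [M.Finitary]
    (hD : (M ／ C).IsCircuit D) (hmax : ∀ Z, M.IsCircuit Z → Z.ncard ≤ D.ncard) :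
    M.IsCircuit D := by
  obtain ⟨Z, hZ, hDZ, -⟩ := hD.exists_subset_isCircuit_of_contract
  rwa [eq_of_subset_of_ncard_le hDZ (hmax Z hZ) hZ.finite]

theorem eq_or_eq_of_contract_isCircuit (hC : M.IsCircuit C) (hD : (M ／ C).IsCircuit D)
    (hD' : M.IsCircuit D) (hY : M.IsCircuit Y) (hYCD : Y ⊆ C ∪ D) : Y = C ∨ Y = D := by
  refine or_iff_not_imp_left.2 fun hYC ↦ ?_
  have hdep : (M ／ C).Dep (Y \ C) :=
    hY.contract_dep_of_not_subset fun h ↦ hYC (hY.eq_of_subset_isCircuit hC h)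
  have hYD : Y \ C ⊆ D := sdiff_subset_iff.2 hYCD
  have hDY : Y \ C = D := hD.eq_of_dep_subset hdep hYD
  exact (hD'.eq_of_subset_isCircuit hY (hDY ▸ sdiff_subset)).symm

theorem ncard_lt_of_contract_isCircuit_of_isLink [M.Finitary] (hC : M.IsCircuit C)
    (hmax : ∀ Z, M.IsCircuit Z → Z.ncard ≤ C.ncard) (hD : (M ／ C).IsCircuit D)
    (hZ : IsLink M C D Z) : D.ncard < C.ncard := by
  by_contra! hle
  have hD' : M.IsCircuit D :=
    isCircuit_of_contract_isCircuit_of_forall_ncard_le hD fun Z hZ ↦ (hmax Z hZ).trans hle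
  have hCD : Disjoint C D := (subset_sdiff.1 hD.subset_ground).2.symm
  obtain ⟨Z, hZ⟩ := hZ.exists_isMinimalLink
  have hZCD : ¬ Z ⊆ C ∪ D := fun h ↦ by
    rcases eq_or_eq_of_contract_isCircuit hC hD hD' hZ.1.isCircuit h with rfl | rfl
    · exact hZ.1.inter_right_nonempty.ne_empty hCD.inter_eq
    · exact hZ.1.inter_left_nonempty.ne_empty hCD.symm.inter_eq
  obtain ⟨w, hw⟩ := sdiff_nonempty.2 hZCD
  obtain ⟨Y, hY, hlt⟩ := exists_isCircuit_ncard_add_ncard_lt hC hD' hCD hZ.1 hw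
    fun Y hY hYZ hwY ↦ hZ.eq_or_eq_of_notMem hC hD' hw hY hYZ hwY
  have hYC := hmax Y hY
  lia

theorem ncard_lt_of_contract_isCircuit [M.Finitary] (hM : NonloopsConnected M)
    (hC : M.IsCircuit C) (hC_one : 1 < C.ncard) (hmax : ∀ Z, M.IsCircuit Z → Z.ncard ≤ C.ncard)
    (hD : (M ／ C).IsCircuit D) : D.ncard < C.ncard := by
  rcases le_or_gt D.ncard 1 with hD_one | hD_one
  · exact hD_one.trans_lt hC_one
  obtain ⟨e, heC⟩ := hC.nonempty
  obtain ⟨d, hdD⟩ := hD.nonempty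
  have he : M.IsNonloop e :=
    hC.isNonloop_of_mem (one_lt_ncard_iff_nontrivial_and_finite.1 hC_one).1 heC
  have hd : M.IsNonloop d :=
    (hD.isNonloop_of_mem (one_lt_ncard_iff_nontrivial_and_finite.1 hD_one).1 hdD).of_contract
  have hed : e ≠ d := fun h ↦ (hD.subset_ground hdD).2 (h ▸ heC)
  obtain ⟨Z, hZ, heZ, hdZ⟩ := hM he hd hed
  exact ncard_lt_of_contract_isCircuit_of_isLink hC hmax hD ⟨hZ, ⟨e, heZ, heC⟩, d, hdZ, hdD⟩

end Circuits

section DepthLabeling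

variable {α β γ : Type*} {M : Matroid α} {f : α → List β} {C S X Y : Set α} {d d' k : ℕ} {b : β}

/-- The nonempty suffixes of the lists `f x` with `x ∈ X`. Identifying a list with a vertex of the
tree in which the parent of a nonempty list is its tail, and a nonempty list with the edge to its
parent, this is the edge set of `T*(X)`. -/
def suffixSet (f : α → List β) (X : Set α) : Set (List β) :=
  {l | l ≠ [] ∧ ∃ x ∈ X, l <:+ f x}

theorem suffixSet_mono (h : X ⊆ Y) : suffixSet f X ⊆ suffixSet f Y :=
  fun _ ⟨hl, x, hx, hlx⟩ ↦ ⟨hl, x, h hx, hlx⟩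

@[simp]
theorem suffixSet_empty : suffixSet f ∅ = ∅ := by
  simp [suffixSet]

theorem suffixSet_append_singleton (f : α → List β) (b : β) (hX : X.Nonempty) :
    suffixSet (fun x ↦ f x ++ [b]) X = (· ++ [b]) '' insert [] (suffixSet f X) := by
  ext l
  constructor
  · rintro ⟨hl, x, hx, hlx⟩
    obtain ⟨t, rfl, ht⟩ := (List.suffix_concat_iff.1 hlx).resolve_left hl
    exact ⟨t, or_iff_not_imp_left.2 fun ht_nil ↦ ⟨ht_nil, x, hx, ht⟩, rfl⟩
  · rintro ⟨t, rfl | ⟨-, x, hx, htx⟩, rfl⟩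
    · exact ⟨by simp, hX.some, hX.some_mem, List.suffix_append _ _⟩
    · exact ⟨by simp, x, hx, List.suffix_append_self_iff.2 htx⟩

theorem encard_suffixSet_append_replicate (f : α → List β) (b : β) (k : ℕ) (hX : X.Nonempty) :
    (suffixSet (fun x ↦ f x ++ List.replicate k b) X).encard = (suffixSet f X).encard + k := by
  induction k with
  | zero => simp
  | succ k ih =>
    simp only [List.replicate_succ', ← List.append_assoc]
    rw [suffixSet_append_singleton _ _ hX, (List.append_left_injective [b]).encard_image,
      encard_insert_of_notMem fun h ↦ h.1 rfl, ih, add_assoc, Nat.cast_succ]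

theorem encard_suffixSet_replicate (b : β) (k : ℕ) (hX : X.Nonempty) :
    (suffixSet (fun _ ↦ List.replicate k b) X).encard = k := by
  have h_nil : suffixSet (fun _ : α ↦ ([] : List β)) X = ∅ := by
    simp +contextual [suffixSet, eq_empty_iff_forall_notMem]
  simpa only [List.nil_append, h_nil, encard_empty, zero_add] using
    encard_suffixSet_append_replicate (fun _ ↦ []) b k hX

theorem suffixSet_map (g : β → γ) (f : α → List β) (X : Set α) :
    suffixSet (fun x ↦ (f x).map g) X = List.map g '' suffixSet f X := by
  ext l
  constructor
  · rintro ⟨hl, x, hx, hlx⟩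
    obtain ⟨t, ht, rfl⟩ := List.suffix_map_iff.1 hlx
    exact ⟨t, ⟨mt (congrArg (List.map g)) hl, x, hx, ht⟩, rfl⟩
  · rintro ⟨t, ⟨ht, x, hx, htx⟩, rfl⟩
    exact ⟨mt List.map_eq_nil_iff.1 ht, x, hx, htx.map g⟩

theorem suffixSet_piecewise (f₁ f₂ : α → List β) (S X : Set α) [∀ x, Decidable (x ∈ S)] :
    suffixSet (S.piecewise f₁ f₂) X = suffixSet f₁ (X ∩ S) ∪ suffixSet f₂ (X \ S) := by
  ext l
  constructor
  · rintro ⟨hl, x, hx, hlx⟩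
    by_cases hxS : x ∈ S
    · exact .inl ⟨hl, x, ⟨hx, hxS⟩, by simpa only [piecewise_eq_of_mem _ _ _ hxS] using hlx⟩
    · exact .inr ⟨hl, x, ⟨hx, hxS⟩, by simpa only [piecewise_eq_of_notMem _ _ _ hxS] using hlx⟩
  · rintro (⟨hl, x, ⟨hx, hxS⟩, hlx⟩ | ⟨hl, x, ⟨hx, hxS⟩, hlx⟩)
    · exact ⟨hl, x, hx, by rwa [piecewise_eq_of_mem _ _ _ hxS]⟩
    · exact ⟨hl, x, hx, by rwa [piecewise_eq_of_notMem _ _ _ hxS]⟩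

theorem disjoint_suffixSet_map {g₁ g₂ : β → γ} (hg : ∀ b b', g₁ b ≠ g₂ b')
    (f₁ f₂ : α → List β) (X Y : Set α) :
    Disjoint (suffixSet (fun x ↦ (f₁ x).map g₁) X) (suffixSet (fun x ↦ (f₂ x).map g₂) Y) := by
  rw [suffixSet_map, suffixSet_map, disjoint_left]
  rintro _ ⟨l, ⟨hl, -⟩, rfl⟩ ⟨l', -, hll'⟩
  obtain ⟨b, t, rfl⟩ := List.exists_cons_of_ne_nil hl
  obtain ⟨b', t', rfl, hbb', -⟩ := List.map_eq_cons_iff.1 hll'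
  exact hg b b' hbb'.symm

/-- A depth-decomposition of `M` of depth at most `d`, given by the map `f` alone: in the tree on
the suffixes of the lists `f x`, the root is the empty list and the parent of a nonempty list is
its tail. -/
structure IsDepthLabeling (M : Matroid α) (f : α → List β) (d : ℕ) : Prop where
  length_le : ∀ x, (f x).length ≤ d
  encard_le : (suffixSet f univ).encard ≤ M.eRank
  eRk_le : ∀ X, M.eRk X ≤ (suffixSet f X).encard

theorem IsDepthLabeling.mono (hf : IsDepthLabeling M f d) (hd : d ≤ d') :
    IsDepthLabeling M f d' where
  __ := hf
  length_le x := (hf.length_le x).trans hd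

theorem isDepthLabeling_replicate (b : β) (h : M.eRank = k) :
    IsDepthLabeling M (fun _ ↦ List.replicate k b) k where
  length_le := by simp
  encard_le := by
    obtain h_univ | h_univ := (univ : Set α).eq_empty_or_nonempty
    · simp [h_univ]
    · rw [encard_suffixSet_replicate b k h_univ, h]
  eRk_le X := by
    obtain rfl | hX := X.eq_empty_or_nonempty
    · simp
    · rw [encard_suffixSet_replicate b k hX, ← h]
      exact M.eRk_le_eRank X

/-- The tree of `M` consists of a path of length `r(C)` at the root, with the tree of `M ／ C`
attached to its end. -/
theorem IsDepthLabeling.of_contract (b : β) (hf : IsDepthLabeling (M ／ C) f d) (hk : M.eRk C = k) :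
    IsDepthLabeling M (fun x ↦ f x ++ List.replicate k b) (d + k) where
  length_le x := by simpa using hf.length_le x
  encard_le := by
    obtain h_univ | h_univ := (univ : Set α).eq_empty_or_nonempty
    · simp [h_univ]
    rw [encard_suffixSet_append_replicate f b k h_univ, eRank_eq_contract_eRank_add_eRk M C, hk]
    gcongr
    exact hf.encard_le
  eRk_le X := by
    obtain rfl | hX := X.eq_empty_or_nonempty
    · simp
    calc
      M.eRk X ≤ M.eRk (X ∪ C) := M.eRk_mono subset_union_left
      _ = (M ／ C).eRk X + k := by rw [eRk_union_eq_contract_eRk_add_eRk, hk]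
      _ ≤ (suffixSet f X).encard + k := by gcongr; exact hf.eRk_le X
      _ = _ := (encard_suffixSet_append_replicate f b k hX).symm

/-- The trees of the two sides of a separation are glued at their roots. -/
theorem IsDepthLabeling.piecewise_map [∀ x, Decidable (x ∈ S)] {f₁ f₂ : α → List β} {g₁ g₂ : β → γ}
    (hf₁ : IsDepthLabeling (M ＼ Sᶜ) f₁ d) (hf₂ : IsDepthLabeling (M ＼ S) f₂ d)
    (hS : M.eRk S + M.eRk Sᶜ ≤ M.eRank) (hg₁ : g₁.Injective) (hg₂ : g₂.Injective)
    (hg : ∀ b b', g₁ b ≠ g₂ b') :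
    IsDepthLabeling M (S.piecewise (fun x ↦ (f₁ x).map g₁) fun x ↦ (f₂ x).map g₂) d := by
  have h_encard : ∀ X, (suffixSet (S.piecewise (fun x ↦ (f₁ x).map g₁) fun x ↦ (f₂ x).map g₂)
      X).encard = (suffixSet f₁ (X ∩ S)).encard + (suffixSet f₂ (X \ S)).encard := fun X ↦ by
    rw [suffixSet_piecewise, encard_union_eq (disjoint_suffixSet_map hg f₁ f₂ _ _), suffixSet_map,
      suffixSet_map, (List.map_injective_iff.2 hg₁).encard_image,
      (List.map_injective_iff.2 hg₂).encard_image]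
  refine ⟨fun x ↦ ?_, ?_, fun X ↦ ?_⟩
  · by_cases hx : x ∈ S
    · simpa [hx] using hf₁.length_le x
    · simpa [hx] using hf₂.length_le x
  · calc
      _ ≤ (suffixSet f₁ univ).encard + (suffixSet f₂ univ).encard := by
        rw [h_encard]
        gcongr <;> exact suffixSet_mono (subset_univ _)
      _ ≤ (M ＼ Sᶜ).eRank + (M ＼ S).eRank := add_le_add hf₁.encard_le hf₂.encard_le
      _ ≤ M.eRank := by rwa [delete_eRank, delete_eRank, compl_compl]
  · calc
      M.eRk X ≤ M.eRk (X ∩ S) + M.eRk (X \ S) := M.eRk_le_eRk_inter_add_eRk_sdiff X S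
      _ = (M ＼ Sᶜ).eRk (X ∩ S) + (M ＼ S).eRk (X \ S) := by
        rw [delete_eRk, delete_eRk, sdiff_compl, inter_assoc, inter_self, sdiff_sdiff, union_self]
      _ ≤ _ := by
        rw [h_encard]
        exact add_le_add (hf₁.eRk_le _) (hf₂.eRk_le _)

end DepthLabeling

section ListTree

variable {β : Type*} {N : Set (List β)} {u v : N} {d : ℕ}

/-- The vertex sets of the trees on lists in which the root is the empty list and the parent of a
nonempty list is its tail. -/
structure IsTailClosed (N : Set (List β)) : Prop where
  nil_mem : [] ∈ N
  tail_mem : ∀ ⦃l⦄, l ∈ N → l.tail ∈ N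

/-- The graph on `N` in which every nonempty list is adjacent to its tail. -/
def tailTree (N : Set (List β)) : SimpleGraph N :=
  SimpleGraph.fromRel fun u v ↦ u.1.tail = v.1

theorem tailTree_adj : (tailTree N).Adj u v ↔ u ≠ v ∧ (u.1.tail = v.1 ∨ v.1.tail = u.1) :=
  SimpleGraph.fromRel_adj _ _ _

namespace IsTailClosed

/-- The empty list, as a vertex of `tailTree N`. -/
def root (hN : IsTailClosed N) : N :=
  ⟨[], hN.nil_mem⟩

/-- The tail of `v`, as a vertex of `tailTree N`. -/
def parent (hN : IsTailClosed N) (v : N) : N :=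
  ⟨v.1.tail, hN.tail_mem v.2⟩

/-- The edge of `tailTree N` between `v` and its parent. At the root this is a loop, which is not
an edge of `tailTree N`. -/
def parentEdge (hN : IsTailClosed N) (v : N) : Sym2 N :=
  s(v, hN.parent v)

theorem mem_of_suffix (hN : IsTailClosed N) {l l' : List β} (hl : l ∈ N) (h : l' <:+ l) :
    l' ∈ N := by
  induction l with
  | nil => rwa [List.suffix_nil.1 h]
  | cons b l ih =>
    obtain rfl | h := List.suffix_cons_iff.1 h
    · exact hl
    · exact ih (hN.tail_mem hl) h

theorem length_parent_lt (hN : IsTailClosed N) (hv : v.1 ≠ []) :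
    (hN.parent v).1.length < v.1.length :=
  Nat.lt_of_succ_le (List.length_tail_add_one v.1 (List.length_pos_iff.2 hv)).le

theorem adj_parent (hN : IsTailClosed N) (hv : v.1 ≠ []) : (tailTree N).Adj v (hN.parent v) :=
  tailTree_adj.2
    ⟨fun h ↦ (hN.length_parent_lt hv).ne (congrArg (fun u ↦ u.1.length) h.symm), .inl rfl⟩

/-- The walk from `l` to the root through the suffixes of `l`. -/
def walkToRoot (hN : IsTailClosed N) : ∀ (l : List β) (hl : l ∈ N),
    (tailTree N).Walk ⟨l, hl⟩ hN.root
  | [], _ => .nil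
  | _ :: l, hl => .cons (hN.adj_parent (List.cons_ne_nil _ _)) (hN.walkToRoot l (hN.tail_mem hl))

theorem length_walkToRoot (hN : IsTailClosed N) (l : List β) (hl : l ∈ N) :
    (hN.walkToRoot l hl).length = l.length := by
  induction l with
  | nil => rfl
  | cons b l ih => exact congrArg Nat.succ (ih (hN.tail_mem hl))

theorem suffix_of_mem_support_walkToRoot (hN : IsTailClosed N) {l : List β} {hl : l ∈ N}
    (hv : v ∈ (hN.walkToRoot l hl).support) : v.1 <:+ l := by
  induction l with
  | nil => exact (List.mem_singleton.1 hv) ▸ List.suffix_rfl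
  | cons b l ih =>
    obtain rfl | hv := List.mem_cons.1 hv
    · exact List.suffix_rfl
    · exact (ih hv).trans (List.suffix_cons b l)

theorem isPath_walkToRoot (hN : IsTailClosed N) (l : List β) (hl : l ∈ N) :
    (hN.walkToRoot l hl).IsPath := by
  induction l with
  | nil => exact .nil
  | cons b l ih =>
    refine (SimpleGraph.Walk.cons_isPath_iff _ _).2 ⟨ih (hN.tail_mem hl), fun h ↦ ?_⟩
    exact (hN.suffix_of_mem_support_walkToRoot h).length_le.not_gt (Nat.lt_succ_self _)

theorem parentEdge_mem_edges_walkToRoot (hN : IsTailClosed N) {l : List β} (hl : l ∈ N)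
    (hv : v.1 ≠ []) (hvl : v.1 <:+ l) : hN.parentEdge v ∈ (hN.walkToRoot l hl).edges := by
  induction l with
  | nil => exact absurd (List.suffix_nil.1 hvl) hv
  | cons b l ih =>
    obtain hvl | hvl := List.suffix_cons_iff.1 hvl
    · obtain rfl : v = ⟨b :: l, hl⟩ := Subtype.ext hvl
      exact List.mem_cons_self
    · exact List.mem_cons_of_mem _ (ih (hN.tail_mem hl) hvl)

theorem injOn_parentEdge (hN : IsTailClosed N) : InjOn hN.parentEdge {v | v.1 ≠ []} := by
  rintro u hu v hv huv
  obtain ⟨huv, -⟩ | ⟨hu_eq, hv_eq⟩ := Sym2.eq_iff.1 huv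
  · exact huv
  · have hlt_u := hN.length_parent_lt hu
    have hlt_v := hN.length_parent_lt hv
    rw [hv_eq] at hlt_u
    rw [← hu_eq] at hlt_v
    exact (hlt_u.asymm hlt_v).elim

theorem edgeSet_tailTree (hN : IsTailClosed N) :
    (tailTree N).edgeSet = hN.parentEdge '' {v | v.1 ≠ []} := by
  have eq_parentEdge : ∀ {u v : N}, u ≠ v → u.1.tail = v.1 → u.1 ≠ [] ∧ hN.parent u = v :=
    fun huv h ↦ ⟨fun hu ↦ huv (Subtype.ext (by rw [← h, hu, List.tail_nil])), Subtype.ext h⟩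
  ext e
  induction e using Sym2.ind with | _ u v => ?_
  refine ⟨fun h ↦ ?_, ?_⟩
  · obtain ⟨huv, h | h⟩ := (tailTree_adj (u := u) (v := v)).1 h
    · obtain ⟨hu, rfl⟩ := eq_parentEdge huv h
      exact ⟨u, hu, rfl⟩
    · obtain ⟨hv, rfl⟩ := eq_parentEdge huv.symm h
      exact ⟨v, hv, Sym2.eq_swap⟩
  · rintro ⟨w, hw, hwe⟩
    exact hwe ▸ hN.adj_parent hw

theorem encard_edgeSet_tailTree (hN : IsTailClosed N) :
    (tailTree N).edgeSet.encard = (N \ {[]}).encard := by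
  rw [hN.edgeSet_tailTree, hN.injOn_parentEdge.encard_image,
    ← Subtype.val_injective.encard_image]
  congr 1
  ext l
  simp [and_comm]

theorem isTree_tailTree (hN : IsTailClosed N) (hN_fin : N.Finite) : (tailTree N).IsTree := by
  have := hN_fin.to_subtype
  have : Nonempty N := ⟨hN.root⟩
  rw [SimpleGraph.isTree_iff_connected_and_card]
  constructor
  · have reachable_root : ∀ v, (tailTree N).Reachable v hN.root := fun v ↦
      (hN.walkToRoot v.1 v.2).reachable
    exact ⟨fun u v ↦ (reachable_root u).trans (reachable_root v).symm⟩
  · rw [Nat.card_coe_set_eq, Nat.card_coe_set_eq, ncard_def, hN.encard_edgeSet_tailTree,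
      ← ncard_def, ncard_sdiff_singleton_add_one hN.nil_mem hN_fin]

/-- The path from the root to `v`. -/
def pathFromRoot (hN : IsTailClosed N) (v : N) : (tailTree N).Path hN.root v :=
  ⟨(hN.walkToRoot v.1 v.2).reverse, (hN.isPath_walkToRoot v.1 v.2).reverse⟩

theorem rootedDepth_tailTree_le (hN : IsTailClosed N) (hN_fin : N.Finite)
    (hd : ∀ l ∈ N, l.length ≤ d) : (tailTree N).rootedDepth hN.root ≤ d := by
  refine iSup₂_le fun v p ↦ ?_
  have := (hN.isTree_tailTree hN_fin).isAcyclic.subsingleton_path hN.root v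
  rw [Subsingleton.elim p (hN.pathFromRoot v)]
  simpa only [pathFromRoot, SimpleGraph.Walk.length_reverse, length_walkToRoot, Nat.cast_le]
    using hd v.1 v.2

theorem encard_suffixSet_le_encard_rootPathEdges {α : Type*} (hN : IsTailClosed N) (f : α → N)
    (X : Set α) : (suffixSet (fun x ↦ (f x).1) X).encard ≤
      ((tailTree N).rootPathEdges hN.root (f '' X)).encard := by
  have h_image : suffixSet (fun x ↦ (f x).1) X ⊆
      Subtype.val '' {v : N | v.1 ≠ [] ∧ ∃ x ∈ X, v.1 <:+ (f x).1} :=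
    fun l ⟨hl, x, hx, hlx⟩ ↦ ⟨⟨l, hN.mem_of_suffix (f x).2 hlx⟩, ⟨hl, x, hx, hlx⟩, rfl⟩
  refine (encard_le_encard h_image).trans ?_
  rw [Subtype.val_injective.encard_image,
    ← (hN.injOn_parentEdge.mono fun _ hv ↦ hv.1).encard_image]
  refine encard_le_encard ?_
  rintro _ ⟨v, ⟨hv, x, hx, hvx⟩, rfl⟩
  refine ⟨f x, mem_image_of_mem f hx, hN.pathFromRoot (f x), ?_⟩
  simpa only [pathFromRoot, SimpleGraph.Walk.edges_reverse, List.mem_reverse]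
    using hN.parentEdge_mem_edges_walkToRoot (f x).2 hv hvx

end IsTailClosed

theorem IsDepthLabeling.branchDepth_le {α : Type*} {β : Type} {M : Matroid α} [M.RankFinite]
    {f : α → List β} (hf : IsDepthLabeling M f d) : M.branchDepth ≤ d := by
  let N : Set (List β) := insert [] (suffixSet f univ)
  have hN : IsTailClosed N := by
    refine ⟨mem_insert _ _, ?_⟩
    rintro l (rfl | ⟨-, x, -, hlx⟩)
    · exact mem_insert _ _
    · exact or_iff_not_imp_left.2 fun hl ↦ ⟨hl, x, mem_univ x, (List.tail_suffix l).trans hlx⟩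
  have hN_nil : N \ {[]} = suffixSet f univ := insert_sdiff_self_of_notMem fun h ↦ h.1 rfl
  have hN_fin : N.Finite := (encard_lt_top_iff.1
    (hf.encard_le.trans_lt (eRank_lt_top_iff.2 inferInstance))).insert []
  have hN_length : ∀ l ∈ N, l.length ≤ d := by
    rintro l (rfl | ⟨-, x, -, hlx⟩)
    · exact Nat.zero_le d
    · exact hlx.length_le.trans (hf.length_le x)
  have hfN : ∀ x, f x ∈ N := fun x ↦
    or_iff_not_imp_left.2 fun hx ↦ ⟨hx, x, mem_univ x, List.suffix_rfl⟩
  have h_eRank : M.eRank = (tailTree N).edgeSet.encard := by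
    rw [hN.encard_edgeSet_tailTree, hN_nil]
    exact (M.eRk_univ_eq.symm.trans_le (hf.eRk_le univ)).antisymm hf.encard_le
  have h_decomp : M.IsDepthDecomposition (tailTree N) hN.root fun x ↦ ⟨f x, hfN x⟩ :=
    ⟨hN.isTree_tailTree hN_fin, h_eRank, fun X _ ↦ (hf.eRk_le X).trans
      (hN.encard_suffixSet_le_encard_rootPathEdges (fun x ↦ ⟨f x, hfN x⟩) X)⟩
  exact sInf_le_of_le ⟨N, hN_fin.to_subtype, _, _, _, h_decomp, rfl⟩
    (hN.rootedDepth_tailTree_le hN_fin hN_length)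

end ListTree

section Recursion

variable {α : Type*} {d n : ℕ}

theorem exists_isDepthLabeling_of_forall_nonloopsConnected
    (hd : ∀ (M : Matroid α) [M.RankFinite], (∀ C, M.IsCircuit C → C.ncard ≤ n) →
      NonloopsConnected M → ∃ f : α → List ℕ, IsDepthLabeling M f d)
    (M : Matroid α) [M.RankFinite] (hM : ∀ C, M.IsCircuit C → C.ncard ≤ n) :
    ∃ f : α → List ℕ, IsDepthLabeling M f d := by
  classical
  induction hr : M.eRank using WellFoundedLT.induction generalizing M with | _ r ih => ?_
  subst hr
  by_cases hM_conn : NonloopsConnected M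
  · exact hd M hM hM_conn
  obtain ⟨S, hS, hS_ne, hS_compl_ne⟩ :=
    exists_eRk_add_eRk_compl_eq_eRank_of_not_nonloopsConnected hM_conn
  have hM_delete : ∀ D C, (M ＼ D).IsCircuit C → C.ncard ≤ n := fun D C hC ↦ hM C hC.of_delete
  have eRk_ne_top : ∀ X, M.eRk X ≠ ⊤ := fun X ↦ eRk_ne_top_iff.2 (M.isRkFinite_set X)
  have h_lt : M.eRk S < M.eRank := by
    rw [← hS, add_comm]
    exact ENat.lt_add_left (eRk_ne_top S) (pos_iff_ne_zero.2 hS_compl_ne)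
  have h_compl_lt : M.eRk Sᶜ < M.eRank :=
    hS ▸ ENat.lt_add_left (eRk_ne_top Sᶜ) (pos_iff_ne_zero.2 hS_ne)
  obtain ⟨f₁, hf₁⟩ := ih _ (by rwa [delete_eRank, compl_compl]) (M ＼ Sᶜ) (hM_delete _) rfl
  obtain ⟨f₂, hf₂⟩ := ih _ (by rwa [delete_eRank]) (M ＼ S) (hM_delete _) rfl
  exact ⟨_, hf₁.piecewise_map hf₂ hS.le (g₁ := (2 * ·)) (g₂ := (2 * · + 1))
    (fun _ _ _ ↦ by lia) (fun _ _ _ ↦ by lia) fun _ _ ↦ by lia⟩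

theorem NonloopsConnected.eRank_le_one {M : Matroid α} [M.Finitary] (hM : NonloopsConnected M)
    (h_ncard : ∀ C, M.IsCircuit C → C.ncard ≤ 1) : M.eRank ≤ 1 := by
  obtain ⟨B, hB⟩ := M.exists_isBase
  rw [← hB.encard_eq_eRank, encard_le_one_iff]
  intro x y hx hy
  by_contra hxy
  obtain ⟨Z, hZ, hxZ, hyZ⟩ :=
    hM (hB.indep.isNonloop_of_mem hx) (hB.indep.isNonloop_of_mem hy) hxy
  exact hxy ((ncard_le_one hZ.finite).1 (h_ncard Z hZ) x hxZ y hyZ)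

theorem exists_isDepthLabeling_choose_two (n : ℕ) (M : Matroid α) [M.RankFinite]
    (hM : ∀ C, M.IsCircuit C → C.ncard ≤ n + 1) :
    ∃ f : α → List ℕ, IsDepthLabeling M f ((n + 1).choose 2 + 1) := by
  induction n generalizing M with
  | zero =>
    refine exists_isDepthLabeling_of_forall_nonloopsConnected (fun M _ hM hM_conn ↦ ?_) M hM
    obtain ⟨r, hr⟩ := ENat.ne_top_iff_exists.1 (M.eRank_ne_top_iff.2 inferInstance)
    have hr_one : r ≤ 1 := by
      exact_mod_cast hr.trans_le (hM_conn.eRank_le_one hM)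
    exact ⟨_, (isDepthLabeling_replicate 0 hr.symm).mono hr_one⟩
  | succ n ih =>
    refine exists_isDepthLabeling_of_forall_nonloopsConnected (fun M _ hM hM_conn ↦ ?_) M hM
    have h_choose : (n + 2).choose 2 + 1 = (n + 1).choose 2 + 1 + (n + 1) := by
      rw [Nat.choose_succ_succ, Nat.choose_one_right]
      ring
    rw [h_choose]
    by_cases h_exists : ∃ C, M.IsCircuit C ∧ C.ncard = n + 2
    · obtain ⟨C, hC, hC_ncard⟩ := h_exists
      have h_eRk : M.eRk C = (n + 1 : ℕ) := by
        have h := hC.eRk_add_one_eq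
        rw [← hC.finite.cast_ncard_eq, hC_ncard, Nat.cast_succ] at h
        exact WithTop.add_right_cancel ENat.one_ne_top h
      obtain ⟨f, hf⟩ := ih (M ／ C) fun D hD ↦ by
        have h_lt := ncard_lt_of_contract_isCircuit hM_conn hC (by lia) (hC_ncard ▸ hM) hD
        lia
      exact ⟨_, hf.of_contract 0 h_eRk⟩
    · obtain ⟨f, hf⟩ := ih M fun C hC ↦ Nat.le_of_lt_succ <|
        (hM C hC).lt_of_ne fun h ↦ h_exists ⟨C, hC, h⟩
      exact ⟨f, hf.mono (Nat.le_add_right _ _)⟩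

theorem choose_two_add_one_le_sq (hn : n ≠ 0) : n.choose 2 + 1 ≤ n ^ 2 := by
  obtain ⟨m, rfl⟩ := Nat.exists_eq_succ_of_ne_zero hn
  have h_choose : (m + 1).choose 2 ≤ (m + 1) * m := by
    rw [Nat.choose_two_right]
    exact Nat.div_le_self _ _
  calc
    (m + 1).choose 2 + 1 ≤ (m + 1) * m + (m + 1) := by lia
    _ = (m + 1) ^ 2 := by ring

theorem encard_le_of_isGreatest {M : Matroid α} [M.Finitary]
    (hn : IsGreatest {k : ℕ | ∃ C : Set α, M.IsCircuit C ∧ C.encard = k} n)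
    {C : Set α} (hC : M.IsCircuit C) : C.encard ≤ n := by
  rw [← hC.finite.cast_ncard_eq, ENat.natCast_le_natCast]
  exact hn.2 ⟨C, hC, hC.finite.cast_ncard_eq.symm⟩

theorem ne_zero_of_isGreatest {M : Matroid α}
    (hn : IsGreatest {k : ℕ | ∃ C : Set α, M.IsCircuit C ∧ C.encard = k} n) : n ≠ 0 := by
  rintro rfl
  obtain ⟨C, hC, hC_encard⟩ := hn.1
  exact hC.nonempty.ne_empty (encard_eq_zero.1 hC_encard)

end Recursion

end BranchDepth

theorem mainTheorem5_general {α : Type*} (M : Matroid α) [M.RankFinite] (ℓ : ℕ)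
    (hℓ : ∀ C, M.IsCircuit C → C.encard ≤ ℓ) : M.branchDepth ≤ (ℓ.choose 2 + 1 : ℕ) := by
  have h_ncard : ∀ C, M.IsCircuit C → C.ncard ≤ (ℓ - 1) + 1 := fun C hC ↦
    (ENat.natCast_le_natCast.1 (hC.finite.cast_ncard_eq.trans_le (hℓ C hC))).trans (by lia)
  obtain ⟨f, hf⟩ := BranchDepth.exists_isDepthLabeling_choose_two (ℓ - 1) M h_ncard
  have h_choose : (ℓ - 1 + 1).choose 2 = ℓ.choose 2 := by cases ℓ <;> rfl
  exact h_choose ▸ hf.branchDepth_le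

theorem mainTheorem5 {α : Type*} (M : Matroid α) [M.Finite] (ℓ : ℕ)
    (hℓ : IsGreatest {k : ℕ | ∃ C : Set α, M.IsCircuit C ∧ C.encard = k} ℓ) :
    M.branchDepth ≤ (ℓ : ℕ∞) ^ 2 :=
  (mainTheorem5_general M ℓ fun _ ↦ BranchDepth.encard_le_of_isGreatest hℓ).trans
    (mod_cast BranchDepth.choose_two_add_one_le_sq (BranchDepth.ne_zero_of_isGreatest hℓ))
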